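/- Let $m\ge 1$ and let $\mathbf C^{(m)}$ be the complex Clifford algebra generated by $\mathbf e_1,\dots,\mathbf e_m$ with $\mathbf e_j\mathbf e_k+\mathbf e_k\mathbf e_j=-2\delta_{jk}$, with basis $\mathbf e_T=\mathbf e_{j_1}\cdots\mathbf e_{j_l}$ for $T=\{j_1<\dots<j_l\}\subseteq\{1,\dots,m\}$ (and $\mathbf e_\emptyset=1$), and with norm $\left|\sum_T x_T\mathbf e_T\right|=\left(\sum_T|x_T|^2\right)^{1/2}$. Identify $\mathbf R^m$ with the vectors $\underline\xi=\xi_1\mathbf e_1+\dots+\xi_m\mathbf e_m$, and $\mathbf R^{m+1}$ with the para-vectors $x=x_0+\underline x$, where $x_0\in\mathbf R$ and $\underline x\in\mathbf R^m$. For $x\in\mathbf R^{m+1}$ and $\underline\xi\in\mathbf R^m\setminus\{0\}$ put $$e(x,\underline\xi)=e^{i\langle\underline x,\underline\xi\rangle}\left(e^{-x_0|\underline\xi|}\,\tfrac12\Big(1+i\tfrac{\underline\xi}{|\underline\xi|}\Big)+e^{x_0|\underline\xi|}\,\tfrac12\Big(1-i\tfrac{\underline\xi}{|\underline\xi|}\Big)\right)$$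 and, with $B(0,\pi)$ the ball in $\mathbf R^m$ of radius $\pi$ centered at the origin, $$P(w,y)=\frac1{(2\pi)^m}\int_{B(0,\pi)}e(w+y,\underline\xi)\,d\underline\xi\quad(w,y\in\mathbf R^{m+1}),\qquad \mathrm{sinc}_B(x)=P(x,0)=\frac1{(2\pi)^m}\int_{B(0,\pi)}e(x,\underline\xi)\,d\underline\xi .$$ Then there is a constant $M$, depending only on $m$, such that $$|\mathrm{sinc}_B(x)|\le M\,\frac{(1+|x_0|)\,e^{\pi|x_0|}}{|\underline x|^{(m+1)/2}}\qquad\text{for all } x=x_0+\underline x\in\mathbf R^{m+1}\text{ with }|\underline x|\ge1 .$$ -/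

import Mathlib

namespace CliffordPW

open MeasureTheory

/-- The quadratic form `z ↦ -(z₁² + ⋯ + z_m²)` on `ℂ^m`. -/
noncomputable def form (m : ℕ) : QuadraticForm ℂ (Fin m → ℂ) :=
  QuadraticMap.weightedSumSquares ℂ (fun _ : Fin m => (-1 : ℂ))

/-- The complex Clifford algebra `ℂ^{(m)}`, generated by `e₁, …, e_m` with
`e_j e_k + e_k e_j = -2 δ_{jk}`. -/
abbrev Cl (m : ℕ) : Type := CliffordAlgebra (form m)

/-- The generator `e_j`. -/
noncomputable def gen {m : ℕ} (j : Fin m) : Cl m :=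
  CliffordAlgebra.ι (form m) (Pi.single j 1)

theorem form_apply {m : ℕ} (z : Fin m → ℂ) : form m z = -∑ i, z i * z i := by
  simp [form]

/-- The defining relations of the algebra. -/
theorem gen_mul_add_mul {m : ℕ} (j k : Fin m) :
    gen j * gen k + gen k * gen j = if j = k then (-2 : Cl m) else 0 := by
  unfold gen
  rw [CliffordAlgebra.ι_mul_ι_add_swap]
  simp only [QuadraticMap.polar, form_apply, Pi.add_apply, add_mul, mul_add,
    Finset.sum_add_distrib]
  by_cases h : j = k
  · subst h
    simp [Pi.single_apply]
    norm_num [Algebra.algebraMap_eq_smul_one]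
  · simp [Pi.single_apply, h, Ne.symm h]

/-- The ordered product `e_T = e_{j₁} ⋯ e_{j_l}` for `T = {j₁ < ⋯ < j_l}`; `e_∅ = 1`. -/
noncomputable def blade {m : ℕ} (T : Finset (Fin m)) : Cl m :=
  ((T.sort (· ≤ ·)).map gen).prod

theorem contract_wedge {m : ℕ} (d : Module.Dual ℂ (Fin m → ℂ)) (L : List (Fin m))
    (h : ∀ k ∈ L, d (Pi.single k 1) = 0) :
    CliffordAlgebra.contractLeft (Q := (0 : QuadraticForm ℂ (Fin m → ℂ))) d
      (L.map fun k => CliffordAlgebra.ι (0 : QuadraticForm ℂ (Fin m → ℂ))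
        (Pi.single k 1)).prod = 0 := by
  induction L with
  | nil => simp
  | cons k L ih =>
    simp only [List.map_cons, List.prod_cons]
    rw [CliffordAlgebra.contractLeft_ι_mul, h k (by simp),
      ih (fun k' hk' => h k' (by simp [hk']))]
    simp

theorem equivExterior_prod {m : ℕ} (L : List (Fin m)) (hL : L.Nodup) :
    CliffordAlgebra.equivExterior (form m) (L.map gen).prod =
      (L.map fun k => CliffordAlgebra.ι (0 : QuadraticForm ℂ (Fin m → ℂ))
        (Pi.single k 1)).prod := by
  induction L with
  | nil => simp [CliffordAlgebra.changeForm_one]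
  | cons k L ih =>
    obtain ⟨hk, hL'⟩ := List.nodup_cons.mp hL
    have ih' := ih hL'
    simp only [List.map_cons, List.prod_cons]
    unfold gen at ih' ⊢
    simp only [CliffordAlgebra.equivExterior, CliffordAlgebra.changeFormEquiv_apply] at ih' ⊢
    rw [CliffordAlgebra.changeForm_ι_mul, ih', contract_wedge, sub_zero]
    intro l hl
    have hkl : k ≠ l := fun h => hk (h ▸ hl)
    simp only [QuadraticMap.associated_apply, neg_apply, form_apply,
      Pi.add_apply, add_mul, mul_add, Finset.sum_add_distrib]
    simp [Pi.single_apply, hkl, Ne.symm hkl]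

/-- The `2^m` elements `e_T` form a basis of `ℂ^{(m)}`. -/
noncomputable def bladeBasis (m : ℕ) : Module.Basis (Finset (Fin m)) ℂ (Cl m) :=
  (Pi.basisFun ℂ (Fin m)).ExteriorAlgebra.map (CliffordAlgebra.equivExterior (form m)).symm

theorem bladeBasis_apply {m : ℕ} (T : Finset (Fin m)) : bladeBasis m T = blade T := by
  rw [bladeBasis, Module.Basis.map_apply, LinearEquiv.symm_apply_eq, blade,
    equivExterior_prod _ (Finset.sort_nodup _ _), ExteriorAlgebra.basis_apply]
  simp only [Set.powersetCard.prodEquiv_symm_apply, ExteriorAlgebra.ιMulti_family,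
    ExteriorAlgebra.ιMulti_apply]
  have hs : T.sort (· ≤ ·) = List.ofFn (T.orderEmbOfFin rfl) := by
    refine (T.sortedLT_sort).eq_of_mem_iff (T.orderEmbOfFin rfl).strictMono.sortedLT_ofFn ?_
    intro a
    rw [List.mem_ofFn, ← Set.mem_range, Finset.range_orderEmbOfFin]
    simp
  rw [hs, List.map_ofFn]
  congr 2
  funext i
  simp [Set.powersetCard.ofFinEmbEquiv_symm_apply, ExteriorAlgebra.ι]

/-- The coordinates `(x_T)_T` of `x = ∑_T x_T e_T`, in the Hermitian space `ℂ^{2^m}`. -/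
noncomputable def coords (m : ℕ) : Cl m ≃ₗ[ℂ] EuclideanSpace ℂ (Finset (Fin m)) :=
  (bladeBasis m).equivFun.trans (WithLp.linearEquiv 2 ℂ (Finset (Fin m) → ℂ)).symm

/-- `ℂ^{(m)}` carries the norm `|x| = (∑_T |x_T|²)^{1/2}`. -/
noncomputable instance (m : ℕ) : NormedAddCommGroup (Cl m) :=
  NormedAddCommGroup.induced (Cl m) (EuclideanSpace ℂ (Finset (Fin m)))
    (coords m) (coords m).injective

noncomputable instance (m : ℕ) : NormedSpace ℂ (Cl m) :=
  NormedSpace.induced ℂ (Cl m) (EuclideanSpace ℂ (Finset (Fin m))) (coords m)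

theorem norm_eq {m : ℕ} (x : Cl m) :
    ‖x‖ = Real.sqrt (∑ T, ‖(bladeBasis m).repr x T‖ ^ 2) :=
  EuclideanSpace.norm_eq (coords m x)

instance (m : ℕ) : FiniteDimensional ℂ (Cl m) := Module.Basis.finiteDimensional_of_finite
  (bladeBasis m)

instance (m : ℕ) : CompleteSpace (Cl m) := FiniteDimensional.complete ℂ (Cl m)

/-- The space `ℝ^{m+1}` of para-vectors `x = x₀ + x_`, written as pairs `(x₀, x_)`. Euclidean norms
are only taken of the vector part `x_`. -/
abbrev Paravector (m : ℕ) : Type := ℝ × EuclideanSpace ℝ (Fin m)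

/-- The inclusion `ξ ↦ ξ₁ e₁ + ⋯ + ξ_m e_m` of `ℝ^m` in `ℂ^{(m)}`. -/
noncomputable def vec {m : ℕ} (ξ : EuclideanSpace ℝ (Fin m)) : Cl m :=
  ∑ j, (ξ j : ℂ) • gen j

/-- `χ_+(ξ) = (1 + i ξ / |ξ|) / 2`. -/
noncomputable def chiPlus {m : ℕ} (ξ : EuclideanSpace ℝ (Fin m)) : Cl m :=
  (1 / 2 : ℂ) • (1 + (Complex.I / (‖ξ‖ : ℂ)) • vec ξ)

/-- `χ_-(ξ) = (1 - i ξ / |ξ|) / 2`. -/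
noncomputable def chiMinus {m : ℕ} (ξ : EuclideanSpace ℝ (Fin m)) : Cl m :=
  (1 / 2 : ℂ) • (1 - (Complex.I / (‖ξ‖ : ℂ)) • vec ξ)

/-- `e^+(x, ξ) = e^{i⟨x_, ξ⟩} e^{-x₀|ξ|} χ_+(ξ)`. -/
noncomputable def expPlus {m : ℕ} (x : Paravector m) (ξ : EuclideanSpace ℝ (Fin m)) : Cl m :=
  (Complex.exp (Complex.I * (inner ℝ x.2 ξ : ℝ)) * (Real.exp (-(x.1 * ‖ξ‖)) : ℂ)) • chiPlus ξ

/-- `e^-(x, ξ) = e^{i⟨x_, ξ⟩} e^{x₀|ξ|} χ_-(ξ)`. -/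
noncomputable def expMinus {m : ℕ} (x : Paravector m) (ξ : EuclideanSpace ℝ (Fin m)) : Cl m :=
  (Complex.exp (Complex.I * (inner ℝ x.2 ξ : ℝ)) * (Real.exp (x.1 * ‖ξ‖) : ℂ)) • chiMinus ξ

/-- The monogenic exponential function `e(x, ξ)`. -/
noncomputable def monogenicExp {m : ℕ} (x : Paravector m) (ξ : EuclideanSpace ℝ (Fin m)) : Cl m :=
  expPlus x ξ + expMinus x ξ

/-- The kernel `P(w, y) = (2π)^{-m} ∫_{B(0,π)} e(w + y, ξ) dξ`; at `y = x̄` this is the reproducing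
kernel `P(w, x̄)` of the Paley-Wiener space. -/
noncomputable def kernelP {m : ℕ} (w y : Paravector m) : Cl m :=
  ((1 / (2 * Real.pi) ^ m : ℝ) : ℂ) •
    ∫ ξ in Metric.ball (0 : EuclideanSpace ℝ (Fin m)) Real.pi, monogenicExp (w + y) ξ

/-- The function `sinc_B(x) = P(x, 0)`. -/
noncomputable def sincB {m : ℕ} (x : Paravector m) : Cl m := kernelP x 0

theorem continuous_vec {m : ℕ} : Continuous (vec : EuclideanSpace ℝ (Fin m) → Cl m) := by
  unfold vec; fun_prop

theorem norm_vec_le {m : ℕ} (ξ : EuclideanSpace ℝ (Fin m)) :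
    ‖vec ξ‖ ≤ ‖ξ‖ * ∑ j : Fin m, ‖(gen j : Cl m)‖ := by
  unfold vec
  rw [Finset.mul_sum]
  refine (norm_sum_le _ _).trans (Finset.sum_le_sum fun j _ => ?_)
  rw [norm_smul, Complex.norm_real]
  gcongr
  exact PiLp.norm_apply_le ξ j

theorem sincB_eq {m : ℕ} (x : Paravector m) :
    sincB x = ((1 / (2 * Real.pi) ^ m : ℝ) : ℂ) •
      ∫ ξ in Metric.ball (0 : EuclideanSpace ℝ (Fin m)) Real.pi, monogenicExp x ξ := by
  simp [sincB, kernelP]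

/-- The integral that defines `kernelP` converges absolutely. -/
theorem integrableOn_monogenicExp {m : ℕ} (x : Paravector m) :
    IntegrableOn (monogenicExp x)
      (Metric.ball (0 : EuclideanSpace ℝ (Fin m)) Real.pi) := by
  have hu : AEStronglyMeasurable (fun ξ : EuclideanSpace ℝ (Fin m) =>
      (Complex.I / (‖ξ‖ : ℂ)) • (vec ξ : Cl m))
      (volume.restrict (Metric.ball 0 Real.pi)) := by
    have hs : Measurable (fun ξ : EuclideanSpace ℝ (Fin m) => Complex.I / (‖ξ‖ : ℂ)) := by
      fun_prop
    exact hs.aestronglyMeasurable.smul (continuous_vec (m := m)).aestronglyMeasurable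
  have hb : ∀ ξ : EuclideanSpace ℝ (Fin m),
      ‖(Complex.I / (‖ξ‖ : ℂ)) • (vec ξ : Cl m)‖ ≤ ∑ j : Fin m, ‖(gen j : Cl m)‖ := by
    intro ξ
    rw [norm_smul, norm_div, Complex.norm_I, Complex.norm_real, norm_norm]
    by_cases h : ‖ξ‖ = 0
    · rw [h]; simp; positivity
    · have h0 : 0 < ‖ξ‖ := lt_of_le_of_ne (norm_nonneg _) (Ne.symm h)
      calc 1 / ‖ξ‖ * ‖(vec ξ : Cl m)‖
          ≤ 1 / ‖ξ‖ * (‖ξ‖ * ∑ j : Fin m, ‖(gen j : Cl m)‖) := by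
            gcongr; exact norm_vec_le ξ
        _ = _ := by field_simp
  have hball : IsFiniteMeasure
      (volume.restrict (Metric.ball (0 : EuclideanSpace ℝ (Fin m)) Real.pi)) :=
    ⟨by simpa using measure_ball_lt_top⟩
  have hint : Integrable (fun ξ : EuclideanSpace ℝ (Fin m) =>
      (Complex.I / (‖ξ‖ : ℂ)) • (vec ξ : Cl m))
      (volume.restrict (Metric.ball 0 Real.pi)) :=
    Integrable.of_bound hu _ (Filter.Eventually.of_forall hb)
  have hone : Integrable (fun _ : EuclideanSpace ℝ (Fin m) => (1 : Cl m))
      (volume.restrict (Metric.ball 0 Real.pi)) := integrable_const _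
  have key : ∀ (s : ℝ) (g : EuclideanSpace ℝ (Fin m) → Cl m),
      Integrable g (volume.restrict (Metric.ball 0 Real.pi)) →
      Integrable (fun ξ => (Complex.exp (Complex.I * (inner ℝ x.2 ξ : ℝ)) *
        (Real.exp (s * ‖ξ‖) : ℂ)) • g ξ) (volume.restrict (Metric.ball 0 Real.pi)) := by
    intro s g hg
    refine Integrable.bdd_smul (φ := fun ξ : EuclideanSpace ℝ (Fin m) =>
      Complex.exp (Complex.I * (inner ℝ x.2 ξ : ℝ)) * (Real.exp (s * ‖ξ‖) : ℂ)) hg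
      (Real.exp (|s| * Real.pi)) ?_ ?_
    · exact Continuous.aestronglyMeasurable (by fun_prop)
    · refine (ae_restrict_iff' measurableSet_ball).2 (Filter.Eventually.of_forall fun ξ hξ => ?_)
      have hξ' : ‖ξ‖ < Real.pi := by simpa using hξ
      rw [norm_mul, mul_comm Complex.I, Complex.norm_exp_ofReal_mul_I, one_mul,
        Complex.norm_real, Real.norm_eq_abs, Real.abs_exp]
      apply Real.exp_le_exp.2
      calc s * ‖ξ‖ ≤ |s| * ‖ξ‖ := by gcongr; exact le_abs_self s
        _ ≤ |s| * Real.pi := by gcongr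
  have h1 := key (-x.1) _ ((hone.add hint).smul (1 / 2 : ℂ))
  have h2 := key x.1 _ ((hone.sub hint).smul (1 / 2 : ℂ))
  refine (h1.add h2).congr (Filter.Eventually.of_forall fun ξ => ?_)
  simp [monogenicExp, expPlus, expMinus, chiPlus, chiMinus]

end CliffordPW

open MeasureTheory

namespace CliffordPW

/-! Write `r = |x_|`, `u = x_/r` and `a = x₀`. Since `χ_+` and `χ_-` sum to `1` and differ by
`iξ/|ξ|`, the exponential is `e^{ir⟨u,ξ⟩}(cosh(a|ξ|) - i (sinh(a|ξ|)/|ξ|) ξ)` (`monogenicExp_eq`).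
Reflection in the line `ℝu` shows that the integral of the vector term is a multiple of `u`
(`setIntegral_smul_vec`), so only two scalar integrals over the ball remain: the plane wave against
`cosh(a|ξ|)`, and `⟨u,ξ⟩` times the plane wave against `sinh(a|ξ|)/|ξ|`.

The radial weights are removed by writing `f(|ξ|) = f(π) - ∫_{|ξ|}^π f'(ρ) dρ` and exchanging
integrals (`norm_setIntegral_ball_radial_mul_le`). What is left are unweighted integrals over the
balls `B(0,ρ)`, `ρ ≤ π`; the derivative of the weight costs the factor `|a| e^{π|a|}`.

Slicing `B(0,ρ)` orthogonally to `u` and putting `t = ρ cos θ` turns these into `ρ^m ∫_0^π sin^m θ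
e^{irρ cos θ} dθ` and its variant with an extra `ρ cos θ`. The angular integrals are
`O(s^{-(m+1)/2})` with `s = rρ` (`exists_bound_sinInt`): integration by parts raises the power of
`sin` by two and gains `1/s`, starting from van der Corput for power `0` and an explicit primitive
for power `1`. The surviving power `ρ^{(m-1)/2}` is bounded, so the decay is uniform in `ρ`. -/

/-! ### Oscillatory integrals on `[0, π]`: trivial bounds and recursions. -/

/-- The phase `e^{is cos θ}`. -/
noncomputable def cosPhase (s θ : ℝ) : ℂ := Complex.exp (Complex.I * s * Real.cos θ)

theorem norm_cosPhase (s θ : ℝ) : ‖cosPhase s θ‖ = 1 := by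
  rw [cosPhase, show Complex.I * s * Real.cos θ = ((s * Real.cos θ : ℝ) : ℂ) * Complex.I by
    push_cast; ring, Complex.norm_exp_ofReal_mul_I]

@[fun_prop]
theorem continuous_cosPhase (s : ℝ) : Continuous (cosPhase s) := by
  unfold cosPhase; fun_prop

theorem hasDerivAt_cosPhase (s θ : ℝ) :
    HasDerivAt (cosPhase s) (-(Complex.I * s * Real.sin θ) * cosPhase s θ) θ := by
  unfold cosPhase
  have h := ((Real.hasDerivAt_cos θ).ofReal_comp.const_mul (Complex.I * s)).cexp
  convert h using 1
  push_cast; ring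

/-- `∫_0^π sin^n θ e^{is cos θ} dθ`. -/
noncomputable def sinInt (n : ℕ) (s : ℝ) : ℂ :=
  ∫ θ in (0 : ℝ)..Real.pi, (Real.sin θ : ℂ) ^ n * cosPhase s θ

/-- `∫_0^π cos θ sin^n θ e^{is cos θ} dθ`. -/
noncomputable def cosSinInt (n : ℕ) (s : ℝ) : ℂ :=
  ∫ θ in (0 : ℝ)..Real.pi, (Real.cos θ : ℂ) * (Real.sin θ : ℂ) ^ n * cosPhase s θ

theorem norm_sinInt_le (n : ℕ) (s : ℝ) : ‖sinInt n s‖ ≤ Real.pi := by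
  have := intervalIntegral.norm_integral_le_of_norm_le_const (a := 0) (b := Real.pi) (C := 1)
    (f := fun θ : ℝ => (Real.sin θ : ℂ) ^ n * cosPhase s θ) (fun θ _ => by
      rw [norm_mul, norm_cosPhase, mul_one, norm_pow, Complex.norm_real]
      exact pow_le_one₀ (norm_nonneg _) (Real.abs_sin_le_one θ))
  rwa [sub_zero, abs_of_pos Real.pi_pos, one_mul] at this

theorem norm_cosSinInt_le (n : ℕ) (s : ℝ) : ‖cosSinInt n s‖ ≤ Real.pi := by
  have := intervalIntegral.norm_integral_le_of_norm_le_const (a := 0) (b := Real.pi) (C := 1)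
    (f := fun θ : ℝ => (Real.cos θ : ℂ) * (Real.sin θ : ℂ) ^ n * cosPhase s θ) (fun θ _ => by
      rw [norm_mul, norm_cosPhase, mul_one, norm_mul, norm_pow, Complex.norm_real,
        Complex.norm_real]
      exact mul_le_one₀ (Real.abs_cos_le_one θ) (by positivity)
        (pow_le_one₀ (norm_nonneg _) (Real.abs_sin_le_one θ)))
  rwa [sub_zero, abs_of_pos Real.pi_pos, one_mul] at this

theorem hasDerivAt_ofReal_sin (θ : ℝ) :
    HasDerivAt (fun t : ℝ => (Real.sin t : ℂ)) (Real.cos θ : ℂ) θ :=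
  (Real.hasDerivAt_sin θ).ofReal_comp

theorem hasDerivAt_ofReal_cos (θ : ℝ) :
    HasDerivAt (fun t : ℝ => (Real.cos t : ℂ)) (-(Real.sin θ : ℂ)) θ := by
  simpa using (Real.hasDerivAt_cos θ).ofReal_comp

theorem ofReal_cos_sq (θ : ℝ) : (Real.cos θ : ℂ) ^ 2 = 1 - (Real.sin θ : ℂ) ^ 2 := by
  exact_mod_cast Real.cos_sq' θ

/-- Integrate the derivative of `sin^{n+1} θ e^{is cos θ}`; the boundary terms vanish because `sin`
is zero at `0` and `π`. -/
theorem sinInt_add_two (n : ℕ) (s : ℝ) :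
    Complex.I * s * sinInt (n + 2) s = (n + 1) * cosSinInt n s := by
  have hd : ∀ θ ∈ Set.uIcc 0 Real.pi,
      HasDerivAt (fun t : ℝ => (Real.sin t : ℂ) ^ (n + 1) * cosPhase s t)
        (((n : ℂ) + 1) * ((Real.cos θ : ℂ) * (Real.sin θ : ℂ) ^ n * cosPhase s θ) -
          Complex.I * s * ((Real.sin θ : ℂ) ^ (n + 2) * cosPhase s θ)) θ := fun θ _ => by
    refine (((hasDerivAt_ofReal_sin θ).pow (n + 1)).mul (hasDerivAt_cosPhase s θ)).congr_deriv ?_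
    simp only [Pi.pow_apply, Nat.add_sub_cancel]
    push_cast
    ring
  have h := intervalIntegral.integral_eq_sub_of_hasDerivAt hd
    (Continuous.intervalIntegrable (by fun_prop) _ _)
  rw [intervalIntegral.integral_sub (Continuous.intervalIntegrable (by fun_prop) _ _)
    (Continuous.intervalIntegrable (by fun_prop) _ _), intervalIntegral.integral_const_mul,
    intervalIntegral.integral_const_mul] at h
  simp only [Real.sin_pi, Real.sin_zero, Complex.ofReal_zero, zero_pow (Nat.succ_ne_zero n),
    zero_mul, sub_zero] at h
  exact (sub_eq_zero.1 h).symm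

/-- The same integration by parts with primitive `cos θ sin^{n+1} θ e^{is cos θ}`, where `cos²` is
replaced by `1 - sin²` to stay within the two families. -/
theorem cosSinInt_add_two (n : ℕ) (s : ℝ) :
    Complex.I * s * cosSinInt (n + 2) s = (n + 1) * sinInt n s - (n + 2) * sinInt (n + 2) s := by
  have hd : ∀ θ ∈ Set.uIcc 0 Real.pi,
      HasDerivAt (fun t : ℝ => (Real.cos t : ℂ) * ((Real.sin t : ℂ) ^ (n + 1)) * cosPhase s t)
        ((((n : ℂ) + 1) * ((Real.sin θ : ℂ) ^ n * cosPhase s θ) -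
          ((n : ℂ) + 2) * ((Real.sin θ : ℂ) ^ (n + 2) * cosPhase s θ)) -
          Complex.I * s * ((Real.cos θ : ℂ) * (Real.sin θ : ℂ) ^ (n + 2) * cosPhase s θ)) θ :=
      fun θ _ => by
    refine (((hasDerivAt_ofReal_cos θ).mul ((hasDerivAt_ofReal_sin θ).pow (n + 1))).mul
      (hasDerivAt_cosPhase s θ)).congr_deriv ?_
    simp only [Pi.pow_apply, Pi.mul_apply, Nat.add_sub_cancel, Nat.cast_add, Nat.cast_one]
    linear_combination (((n : ℂ) + 1) * (Real.sin θ : ℂ) ^ n * cosPhase s θ) * ofReal_cos_sq θ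
  have h := intervalIntegral.integral_eq_sub_of_hasDerivAt hd
    (Continuous.intervalIntegrable (by fun_prop) _ _)
  rw [intervalIntegral.integral_sub (Continuous.intervalIntegrable (by fun_prop) _ _)
    (Continuous.intervalIntegrable (by fun_prop) _ _),
    intervalIntegral.integral_sub (Continuous.intervalIntegrable (by fun_prop) _ _)
    (Continuous.intervalIntegrable (by fun_prop) _ _), intervalIntegral.integral_const_mul,
    intervalIntegral.integral_const_mul, intervalIntegral.integral_const_mul] at h
  simp only [Real.sin_pi, Real.sin_zero, Complex.ofReal_zero, zero_pow (Nat.succ_ne_zero n),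
    zero_mul, mul_zero, sub_zero] at h
  exact (sub_eq_zero.1 h).symm

theorem norm_I_mul_mul {s : ℝ} (hs : 0 < s) (z : ℂ) : ‖Complex.I * s * z‖ = s * ‖z‖ := by
  rw [norm_mul, norm_mul, Complex.norm_I, one_mul, Complex.norm_real, Real.norm_of_nonneg hs.le]

/-- Up to the factor `-is` the integrand is the derivative of the phase, so only two boundary values
of modulus one remain. -/
theorem norm_sinInt_one_le {s : ℝ} (hs : 0 < s) : s * ‖sinInt 1 s‖ ≤ 2 := by
  have h := intervalIntegral.integral_eq_sub_of_hasDerivAt (a := 0) (b := Real.pi)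
    (fun θ _ => hasDerivAt_cosPhase s θ) (Continuous.intervalIntegrable (by fun_prop) _ _)
  have h' : Complex.I * s * sinInt 1 s = -(cosPhase s Real.pi - cosPhase s 0) := by
    rw [← h, sinInt, ← intervalIntegral.integral_const_mul, ← intervalIntegral.integral_neg]
    congr 1; ext θ; ring
  rw [← norm_I_mul_mul hs, h', norm_neg]
  refine (norm_sub_le _ _).trans ?_
  rw [norm_cosPhase, norm_cosPhase]; norm_num

theorem norm_cosSinInt_one_le {s : ℝ} (hs : 0 < s) :
    s * ‖cosSinInt 1 s‖ ≤ 2 + Real.pi := by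
  have h := intervalIntegral.integral_eq_sub_of_hasDerivAt (a := 0) (b := Real.pi)
    (fun θ _ => (hasDerivAt_ofReal_cos θ).mul (hasDerivAt_cosPhase s θ))
    (Continuous.intervalIntegrable (by fun_prop) _ _)
  have h' : Complex.I * s * cosSinInt 1 s = (cosPhase s Real.pi + cosPhase s 0) - sinInt 1 s := by
    have h2 : (cosPhase s Real.pi + cosPhase s 0) =
        -(((fun t : ℝ => (Real.cos t : ℂ)) * cosPhase s) Real.pi -
          ((fun t : ℝ => (Real.cos t : ℂ)) * cosPhase s) 0) := by
      simp; ring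
    rw [h2, ← h, eq_sub_iff_add_eq, sinInt, cosSinInt, ← intervalIntegral.integral_const_mul,
      ← intervalIntegral.integral_neg,
      ← intervalIntegral.integral_add (Continuous.intervalIntegrable (by fun_prop) _ _)
      (Continuous.intervalIntegrable (by fun_prop) _ _)]
    congr 1; ext θ; ring
  rw [← norm_I_mul_mul hs, h']
  refine (norm_sub_le _ _).trans (add_le_add ((norm_add_le _ _).trans ?_) (norm_sinInt_le _ _))
  rw [norm_cosPhase, norm_cosPhase]; norm_num

/-! ### Van der Corput estimate and the decay rate for every power of the sine. -/

theorem integral_inv_sin_sq {δ : ℝ} (h0 : 0 < δ) (h1 : δ ≤ Real.pi / 2) :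
    ∫ θ in δ..(Real.pi - δ), (1 / Real.sin θ ^ 2) ≤ 2 / Real.sin δ := by
  have hs : ∀ θ ∈ Set.uIcc δ (Real.pi - δ), Real.sin θ ≠ 0 := fun θ hθ => by
    rw [Set.uIcc_of_le (by linarith)] at hθ
    exact (Real.sin_pos_of_pos_of_lt_pi (by linarith [hθ.1]) (by linarith [hθ.2])).ne'
  have hd : ∀ θ ∈ Set.uIcc δ (Real.pi - δ),
      HasDerivAt (fun t => -(Real.cos t / Real.sin t)) (1 / Real.sin θ ^ 2) θ := fun θ hθ => by
    refine ((Real.hasDerivAt_cos θ).div (Real.hasDerivAt_sin θ) (hs θ hθ)).neg.congr_deriv ?_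
    rw [← Real.sin_sq_add_cos_sq θ]; ring
  rw [intervalIntegral.integral_eq_sub_of_hasDerivAt hd (ContinuousOn.intervalIntegrable
    (ContinuousOn.div continuousOn_const (by fun_prop) fun θ hθ => pow_ne_zero _ (hs θ hθ)))]
  rw [Real.cos_pi_sub, Real.sin_pi_sub]
  have : 0 < Real.sin δ := Real.sin_pos_of_pos_of_lt_pi h0 (by linarith [Real.pi_pos])
  rw [neg_div, neg_neg, sub_neg_eq_add, ← add_div]
  gcongr
  linarith [Real.cos_le_one δ]

/-- Van der Corput's estimate for the phase `cos θ`. -/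
theorem norm_integral_cosPhase_le {q q' : ℝ → ℝ} (hq : ∀ θ, HasDerivAt q (q' θ) θ)
    (hq' : Continuous q') (hq1 : ∀ θ, |q θ| ≤ 1)
    (hqq : ∀ θ, |q' θ * Real.sin θ - q θ * Real.cos θ| ≤ 1) {s : ℝ} (hs : 1 ≤ s) :
    ‖∫ θ in (0 : ℝ)..Real.pi, (q θ : ℂ) * cosPhase s θ‖ ≤ (2 + 2 * Real.pi) / Real.sqrt s := by
  have hs0 : 0 < s := by linarith
  have hqc : Continuous q := continuous_iff_continuousAt.2 fun θ => (hq θ).continuousAt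
  -- The phase is stationary at `0` and `π`. Cutting out length `δ` at each end costs `2δ`, while
  -- the middle contributes about `1/(sδ)`; `δ = s^{-1/2}` balances the two.
  set δ : ℝ := 1 / Real.sqrt s with hδ
  have hsq : 1 ≤ Real.sqrt s := Real.one_le_sqrt.2 hs
  have hsq0 : 0 < Real.sqrt s := by linarith
  have hδ0 : 0 < δ := by positivity
  have hδ1 : δ ≤ 1 := by rw [hδ, div_le_one hsq0]; exact hsq
  have hπ := Real.pi_gt_three
  have hδ2 : δ ≤ Real.pi / 2 := by linarith
  have hsin : 2 / Real.pi * δ ≤ Real.sin δ := Real.mul_le_sin hδ0.le hδ2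
  have hsin0 : 0 < Real.sin δ := lt_of_lt_of_le (by positivity) hsin
  have hs' : ∀ θ ∈ Set.uIcc δ (Real.pi - δ), 0 < Real.sin θ := fun θ hθ => by
    rw [Set.uIcc_of_le (by linarith)] at hθ
    exact (Real.sin_pos_of_pos_of_lt_pi (by linarith [hθ.1]) (by linarith [hθ.2]))
  have hii : ∀ a b, IntervalIntegrable (fun θ => (q θ : ℂ) * cosPhase s θ) volume a b :=
    fun a b => Continuous.intervalIntegrable (by fun_prop) _ _
  have hpt : ∀ θ, ‖(q θ : ℂ) * cosPhase s θ‖ ≤ 1 := fun θ => by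
    rw [norm_mul, norm_cosPhase, mul_one, Complex.norm_real]; exact hq1 θ
  have hend1 : ‖∫ θ in (0 : ℝ)..δ, (q θ : ℂ) * cosPhase s θ‖ ≤ δ := by
    simpa [abs_of_pos hδ0] using intervalIntegral.norm_integral_le_of_norm_le_const
      (a := 0) (b := δ) fun θ _ => hpt θ
  have hend2 : ‖∫ θ in (Real.pi - δ)..Real.pi, (q θ : ℂ) * cosPhase s θ‖ ≤ δ := by
    simpa [abs_of_pos hδ0] using intervalIntegral.norm_integral_le_of_norm_le_const
      (a := Real.pi - δ) (b := Real.pi) fun θ _ => hpt θ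
  -- This is `(q / sin)'`, the amplitude left after integrating by parts; `hqq` bounds it by `1 /
  -- sin²`.
  set G' : ℝ → ℝ := fun θ => (q' θ * Real.sin θ - q θ * Real.cos θ) / Real.sin θ ^ 2 with hG'
  have hG'c : ContinuousOn G' (Set.uIcc δ (Real.pi - δ)) :=
    ContinuousOn.div (by fun_prop) (by fun_prop) fun θ hθ => pow_ne_zero _ (hs' θ hθ).ne'
  have hG'i : IntervalIntegrable (fun θ => (G' θ : ℂ) * cosPhase s θ) volume δ (Real.pi - δ) :=
    ContinuousOn.intervalIntegrable
      ((Complex.continuous_ofReal.comp_continuousOn hG'c).mul (by fun_prop))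
  have hd : ∀ θ ∈ Set.uIcc δ (Real.pi - δ),
      HasDerivAt (fun t : ℝ => ((q t / Real.sin t : ℝ) : ℂ) * cosPhase s t)
        ((G' θ : ℂ) * cosPhase s θ - Complex.I * s * ((q θ : ℂ) * cosPhase s θ)) θ :=
      fun θ hθ => by
    refine ((((hq θ).div (Real.hasDerivAt_sin θ) (hs' θ hθ).ne').ofReal_comp).mul
      (hasDerivAt_cosPhase s θ)).congr_deriv ?_
    have : (Real.sin θ : ℂ) ≠ 0 := by exact_mod_cast (hs' θ hθ).ne'
    have h3 : ((q θ / Real.sin θ : ℝ) : ℂ) * (Real.sin θ : ℂ) = q θ := by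
      rw [Complex.ofReal_div, div_mul_cancel₀ _ this]
    simp only [hG', Pi.div_apply]
    linear_combination (-(Complex.I * s * cosPhase s θ)) * h3
  have h := intervalIntegral.integral_eq_sub_of_hasDerivAt hd
    (hG'i.sub ((hii _ _).const_mul _))
  rw [intervalIntegral.integral_sub hG'i ((hii _ _).const_mul _),
    intervalIntegral.integral_const_mul, sub_eq_iff_eq_add', ← sub_eq_iff_eq_add] at h
  have hbd : ∀ t, Real.sin t = Real.sin δ →
      ‖((q t / Real.sin t : ℝ) : ℂ) * cosPhase s t‖ ≤ 1 / Real.sin δ := fun t ht => by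
    rw [norm_mul, norm_cosPhase, mul_one, Complex.norm_real, Real.norm_eq_abs, ht, abs_div,
      abs_of_pos hsin0]
    gcongr; exact hq1 t
  have hmain : s * ‖∫ θ in δ..(Real.pi - δ), (q θ : ℂ) * cosPhase s θ‖ ≤ 4 / Real.sin δ := by
    have h5 : ‖∫ θ in δ..(Real.pi - δ), (G' θ : ℂ) * cosPhase s θ‖ ≤ 2 / Real.sin δ := by
      refine le_trans ?_ (integral_inv_sin_sq hδ0 hδ2)
      refine intervalIntegral.norm_integral_le_of_norm_le (by linarith)
        (Filter.Eventually.of_forall fun θ hθ => ?_) (ContinuousOn.intervalIntegrable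
        (ContinuousOn.div continuousOn_const (by fun_prop) fun θ hθ => pow_ne_zero _ (hs' θ hθ).ne'))
      rw [norm_mul, norm_cosPhase, mul_one, Complex.norm_real, Real.norm_eq_abs, abs_div,
        abs_of_nonneg (sq_nonneg (Real.sin θ))]
      gcongr
      exact hqq θ
    have h6 := hbd δ rfl
    have h7 := hbd (Real.pi - δ) (Real.sin_pi_sub δ)
    rw [← norm_I_mul_mul hs0]
    calc _ = ‖(∫ θ in δ..(Real.pi - δ), (G' θ : ℂ) * cosPhase s θ) -
          (((q (Real.pi - δ) / Real.sin (Real.pi - δ) : ℝ) : ℂ) * cosPhase s (Real.pi - δ) -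
          ((q δ / Real.sin δ : ℝ) : ℂ) * cosPhase s δ)‖ := by
            rw [← h]
      _ ≤ 2 / Real.sin δ + (1 / Real.sin δ + 1 / Real.sin δ) :=
          (norm_sub_le _ _).trans (add_le_add h5 ((norm_sub_le _ _).trans (add_le_add h7 h6)))
      _ = _ := by ring
  have hmain' : ‖∫ θ in δ..(Real.pi - δ), (q θ : ℂ) * cosPhase s θ‖ ≤ 2 * Real.pi * δ := by
    have h8 : 4 / Real.sin δ ≤ 4 / (2 / Real.pi * δ) := by gcongr
    have h9 : s * (2 * Real.pi * δ) = 4 / (2 / Real.pi * δ) := by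
      rw [hδ]; field_simp; rw [Real.sq_sqrt hs0.le]; ring
    exact le_of_mul_le_mul_left (by linarith) hs0
  rw [← intervalIntegral.integral_add_adjacent_intervals (hii 0 δ) (hii δ Real.pi),
    ← intervalIntegral.integral_add_adjacent_intervals (hii δ (Real.pi - δ)) (hii _ Real.pi)]
  calc _ ≤ δ + (2 * Real.pi * δ + δ) := (norm_add_le _ _).trans
        (add_le_add hend1 ((norm_add_le _ _).trans (add_le_add hmain' hend2)))
    _ = _ := by rw [hδ]; ring

theorem norm_sinInt_zero_le {s : ℝ} (hs : 1 ≤ s) :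
    ‖sinInt 0 s‖ ≤ (2 + 2 * Real.pi) / Real.sqrt s := by
  simpa [sinInt] using norm_integral_cosPhase_le (q := fun _ => 1) (q' := fun _ => 0)
    (fun θ => hasDerivAt_const θ 1) continuous_const (by simp)
    (by simpa using Real.abs_cos_le_one) hs

theorem norm_cosSinInt_zero_le {s : ℝ} (hs : 1 ≤ s) :
    ‖cosSinInt 0 s‖ ≤ (2 + 2 * Real.pi) / Real.sqrt s := by
  simpa [cosSinInt] using norm_integral_cosPhase_le (q := Real.cos) (q' := fun θ => -Real.sin θ)
    Real.hasDerivAt_cos (by fun_prop) Real.abs_cos_le_one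
    (fun θ => by
      rw [show -Real.sin θ * Real.sin θ - Real.cos θ * Real.cos θ = -1 by
        linarith [Real.sin_sq_add_cos_sq θ, sq (Real.sin θ), sq (Real.cos θ)]]
      simp) hs

theorem exists_bound_sinInt_of_one_le (n : ℕ) : ∃ C : ℝ, ∀ s : ℝ, 1 ≤ s →
    ‖sinInt n s‖ ≤ C / s ^ (((n : ℝ) + 1) / 2) ∧
      ‖cosSinInt n s‖ ≤ C / s ^ (((n : ℝ) + 1) / 2) := by
  induction n using Nat.twoStepInduction with
  | zero =>
    refine ⟨2 + 2 * Real.pi, fun s hs => ?_⟩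
    have h : s ^ (((0 : ℕ) + 1 : ℝ) / 2) = Real.sqrt s := by
      rw [Real.sqrt_eq_rpow]; norm_num
    rw [h]
    exact ⟨norm_sinInt_zero_le hs, norm_cosSinInt_zero_le hs⟩
  | one =>
    refine ⟨2 + Real.pi, fun s hs => ?_⟩
    have hs0 : 0 < s := by linarith
    have h : s ^ (((1 : ℕ) + 1 : ℝ) / 2) = s := by norm_num
    rw [h, le_div_iff₀' hs0, le_div_iff₀' hs0]
    exact ⟨(norm_sinInt_one_le hs0).trans (by linarith [Real.pi_pos]), norm_cosSinInt_one_le hs0⟩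
  | more n ih _ =>
    obtain ⟨C, hC⟩ := ih
    -- The constant comes from the cosine recursion; its first summand alone serves the integral
    -- without `cos θ`.
    refine ⟨(n + 1) * C + (n + 2) * ((n + 1) * C), fun s hs => ?_⟩
    have hs0 : 0 < s := by linarith
    obtain ⟨hA, hB⟩ := hC s hs
    have hC0 : 0 ≤ C := by
      have := (norm_nonneg _).trans hA
      by_contra hneg
      exact absurd this (not_le.2 (div_neg_of_neg_of_pos (not_le.1 hneg) (by positivity)))
    have hp : s ^ ((((n + 2 : ℕ) : ℝ) + 1) / 2) = s ^ (((n : ℝ) + 1) / 2) * s := by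
      rw [show (((n + 2 : ℕ) : ℝ) + 1) / 2 = ((n : ℝ) + 1) / 2 + 1 by push_cast; ring,
        Real.rpow_add_one hs0.ne']
    set p := s ^ (((n : ℝ) + 1) / 2) with hpdef
    have hp0 : 0 < p := by positivity
    have n1 : ‖(n : ℂ) + 1‖ = n + 1 := by exact_mod_cast Complex.norm_natCast (n + 1)
    have n2 : ‖(n : ℂ) + 2‖ = n + 2 := by exact_mod_cast Complex.norm_natCast (n + 2)
    have hA2 : s * ‖sinInt (n + 2) s‖ ≤ (n + 1) * (C / p) := by
      rw [← norm_I_mul_mul hs0, sinInt_add_two, norm_mul, n1]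
      gcongr
    have hA2' : ‖sinInt (n + 2) s‖ ≤ (n + 1) * (C / p) :=
      le_trans (le_mul_of_one_le_left (norm_nonneg _) hs) hA2
    have hB2 : s * ‖cosSinInt (n + 2) s‖ ≤ (n + 1) * (C / p) + (n + 2) * ((n + 1) * (C / p)) := by
      rw [← norm_I_mul_mul hs0, cosSinInt_add_two]
      refine (norm_sub_le _ _).trans ?_
      rw [norm_mul, norm_mul, n1, n2]
      gcongr
    have e : ((n + 1) * C + (n + 2) * ((n + 1) * C)) / (p * s) * s =
        (n + 1) * (C / p) + (n + 2) * ((n + 1) * (C / p)) := by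
      field_simp
    have hnn : 0 ≤ ((n : ℝ) + 2) * ((n + 1) * (C / p)) := by positivity
    rw [hp]
    constructor
    · refine le_of_mul_le_mul_left (le_trans (hA2.trans ?_) (le_of_eq (mul_comm _ s))) hs0
      rw [e]; linarith
    · refine le_of_mul_le_mul_left (le_trans hB2 (le_of_eq ?_)) hs0
      rw [mul_comm s, e]

/-- Stationary phase bounds for `∫_0^π sin^n θ e^{is cos θ} dθ`, with and without a factor
`cos θ`. -/
theorem exists_bound_sinInt (n : ℕ) : ∃ C : ℝ, 0 ≤ C ∧ ∀ s : ℝ, 0 < s →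
    ‖sinInt n s‖ ≤ C / s ^ (((n : ℝ) + 1) / 2) ∧
      ‖cosSinInt n s‖ ≤ C / s ^ (((n : ℝ) + 1) / 2) := by
  obtain ⟨C, hC⟩ := exists_bound_sinInt_of_one_le n
  refine ⟨max C Real.pi, le_max_of_le_right Real.pi_pos.le, fun s hs => ?_⟩
  have hp : 0 < s ^ (((n : ℝ) + 1) / 2) := by positivity
  rcases le_total 1 s with h | h
  · exact ⟨(hC s h).1.trans (by gcongr; exact le_max_left _ _),
      (hC s h).2.trans (by gcongr; exact le_max_left _ _)⟩
  -- For `s ≤ 1` the trivial bound `π` suffices. This range is needed because `s = rρ` with `ρ`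
  -- arbitrarily small.
  · have : Real.pi ≤ max C Real.pi / s ^ (((n : ℝ) + 1) / 2) := by
      rw [le_div_iff₀ hp]
      refine le_trans (mul_le_of_le_one_right Real.pi_pos.le ?_) (le_max_right _ _)
      exact Real.rpow_le_one hs.le h (by positivity)
    exact ⟨(norm_sinInt_le n s).trans this, (norm_cosSinInt_le n s).trans this⟩

/-! ### Reduction of plane-wave integrals over balls to one dimension. -/

theorem setIntegral_ball_comp_isometry {E X : Type*} [NormedAddCommGroup E]
    [InnerProductSpace ℝ E] [FiniteDimensional ℝ E] [MeasurableSpace E] [BorelSpace E]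
    [NormedAddCommGroup X] [NormedSpace ℝ X] (L : E ≃ₗᵢ[ℝ] E) (F : E → X) (ρ : ℝ) :
    ∫ ξ in Metric.ball (0 : E) ρ, F (L ξ) = ∫ ξ in Metric.ball (0 : E) ρ, F ξ := by
  have h := L.measurePreserving.setIntegral_preimage_emb
    L.toHomeomorph.measurableEmbedding F (Metric.ball (0 : E) ρ)
  rw [← h]
  congr 2
  ext ξ; simp

/-- The splitting `ℝ^{k+1} = ℝ × ℝ^k` along the first coordinate. -/
noncomputable def splitFirst (k : ℕ) :
    EuclideanSpace ℝ (Fin (k + 1)) ≃ᵐ ℝ × EuclideanSpace ℝ (Fin k) :=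
  ((MeasurableEquiv.toLp 2 (Fin (k + 1) → ℝ)).symm.trans
    (MeasurableEquiv.piFinSuccAbove (fun _ => ℝ) 0)).trans
    ((MeasurableEquiv.refl ℝ).prodCongr (MeasurableEquiv.toLp 2 (Fin k → ℝ)))

theorem measurePreserving_splitFirst (k : ℕ) :
    MeasurePreserving (splitFirst k) volume (volume.prod volume) :=
  ((EuclideanSpace.volume_preserving_symm_measurableEquiv_toLp (Fin (k + 1))).trans
    (volume_preserving_piFinSuccAbove (fun _ => ℝ) 0)).trans
    ((MeasurePreserving.id volume).prod (PiLp.volume_preserving_toLp (Fin k)))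

theorem norm_sq_splitFirst {k : ℕ} (ξ : EuclideanSpace ℝ (Fin (k + 1))) :
    ‖ξ‖ ^ 2 = (splitFirst k ξ).1 ^ 2 + ‖(splitFirst k ξ).2‖ ^ 2 := by
  rw [EuclideanSpace.real_norm_sq_eq, EuclideanSpace.real_norm_sq_eq, Fin.sum_univ_succ]
  rfl

theorem setIntegral_ball_coord {k : ℕ} {φ : ℝ → ℂ} (hφ : Continuous φ) {ρ : ℝ} (hρ : 0 < ρ) :
    ∫ ξ in Metric.ball (0 : EuclideanSpace ℝ (Fin (k + 1))) ρ, φ (ξ 0) =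
      ∫ t in (-ρ)..ρ, ((volume.real (Metric.ball (0 : EuclideanSpace ℝ (Fin k)) 1) *
        Real.sqrt (ρ ^ 2 - t ^ 2) ^ k : ℝ) : ℂ) * φ t := by
  set S : Set (ℝ × EuclideanSpace ℝ (Fin k)) := {p | p.1 ^ 2 + ‖p.2‖ ^ 2 < ρ ^ 2} with hS
  have hSm : MeasurableSet S := (isOpen_lt (by fun_prop) (by fun_prop)).measurableSet
  have hpre : Metric.ball (0 : EuclideanSpace ℝ (Fin (k + 1))) ρ = splitFirst k ⁻¹' S := by
    ext ξ
    rw [mem_ball_zero_iff, Set.mem_preimage, hS, Set.mem_ofPred_eq, ← norm_sq_splitFirst,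
      sq_lt_sq₀ (norm_nonneg _) hρ.le]
  have h1 : ∫ ξ in Metric.ball (0 : EuclideanSpace ℝ (Fin (k + 1))) ρ, φ (ξ 0) =
      ∫ p in S, φ p.1 ∂(volume.prod volume) := by
    rw [hpre, ← (measurePreserving_splitFirst k).setIntegral_preimage_emb
      (splitFirst k).measurableEmbedding]
    rfl
  have hint : IntegrableOn (fun p : ℝ × EuclideanSpace ℝ (Fin k) => φ p.1) S
      (volume.prod volume) := by
    refine ((Continuous.continuousOn (by fun_prop)).integrableOn_compact
      ((isCompact_Icc (a := -ρ) (b := ρ)).prod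
      (isCompact_closedBall (0 : EuclideanSpace ℝ (Fin k)) ρ))).mono_set ?_
    rintro ⟨t, η⟩ h
    simp only [hS, Set.mem_ofPred_eq] at h
    refine ⟨?_, ?_⟩
    · exact abs_le.1 (abs_le_of_sq_le_sq (by nlinarith [sq_nonneg ‖η‖]) hρ.le)
    · rw [mem_closedBall_zero_iff]
      exact (sq_le_sq₀ (norm_nonneg _) hρ.le).1 (by nlinarith [sq_nonneg t])
  rw [h1, ← integral_indicator hSm, integral_prod _ (hint.integrable_indicator hSm),
    intervalIntegral.integral_of_le (by linarith), ← integral_indicator measurableSet_Ioc]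
  refine integral_congr_ae ?_
  -- The endpoint `t = ρ` is discarded: its slice is empty, whereas for `k = 0` the claimed slice
  -- volume there is `0 ^ 0 = 1`.
  filter_upwards [compl_mem_ae_iff.2 (measure_singleton (μ := (volume : Measure ℝ)) ρ)] with t ht
  have ht : t ≠ ρ := by simpa using ht
  have hind : ∀ η : EuclideanSpace ℝ (Fin k), S.indicator (fun p => φ p.1) (t, η) =
      {η : EuclideanSpace ℝ (Fin k) | t ^ 2 + ‖η‖ ^ 2 < ρ ^ 2}.indicator (fun _ => φ t) η :=
    fun η => rfl
  simp only [hind]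
  by_cases h : t ∈ Set.Ioc (-ρ) ρ
  · have hlt : 0 < ρ ^ 2 - t ^ 2 := by nlinarith [h.1, lt_of_le_of_ne h.2 ht]
    have hball : {η : EuclideanSpace ℝ (Fin k) | t ^ 2 + ‖η‖ ^ 2 < ρ ^ 2} =
        Metric.ball 0 (Real.sqrt (ρ ^ 2 - t ^ 2)) := by
      ext η
      rw [mem_ball_zero_iff, Real.lt_sqrt (norm_nonneg _), Set.mem_ofPred_eq, lt_sub_iff_add_lt']
    rw [Set.indicator_of_mem h, hball, integral_indicator measurableSet_ball, setIntegral_const,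
      measureReal_def, Measure.addHaar_ball_of_pos _ _ (Real.sqrt_pos.2 hlt), ENNReal.toReal_mul,
      ENNReal.toReal_ofReal (by positivity), finrank_euclideanSpace_fin, Complex.real_smul,
      measureReal_def, mul_comm (Real.sqrt _ ^ k)]
  · rw [Set.indicator_of_notMem h]
    have hempty : {η : EuclideanSpace ℝ (Fin k) | t ^ 2 + ‖η‖ ^ 2 < ρ ^ 2} = ∅ := by
      ext η
      simp only [Set.mem_ofPred_eq, Set.mem_empty_iff_false, iff_false, not_lt]
      have : ρ ^ 2 ≤ t ^ 2 := by
        by_contra hlt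
        have := abs_lt.1 (abs_lt_of_sq_lt_sq (not_le.1 hlt) hρ.le)
        exact h ⟨this.1, this.2.le⟩
      nlinarith [sq_nonneg ‖η‖]
    rw [hempty]; simp

/-- Substitute `t = ρ cos θ`: the root supplies `sin^k θ`, and `dt` supplies one more sine. -/
theorem integral_slices_eq {k : ℕ} {φ : ℝ → ℂ} (hφ : Continuous φ) {ρ : ℝ} (hρ : 0 < ρ) (c : ℝ) :
    ∫ t in (-ρ)..ρ, ((c * Real.sqrt (ρ ^ 2 - t ^ 2) ^ k : ℝ) : ℂ) * φ t =
      ((c * ρ ^ (k + 1) : ℝ) : ℂ) *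
        ∫ θ in (0 : ℝ)..Real.pi, (Real.sin θ : ℂ) ^ (k + 1) * φ (ρ * Real.cos θ) := by
  have h := intervalIntegral.integral_deriv_smul_comp (a := 0) (b := Real.pi)
    (f := fun θ => ρ * Real.cos θ) (f' := fun θ => -(ρ * Real.sin θ))
    (g := fun t => ((c * Real.sqrt (ρ ^ 2 - t ^ 2) ^ k : ℝ) : ℂ) * φ t)
    (fun θ _ => ((Real.hasDerivAt_cos θ).const_mul ρ).congr_deriv (by ring))
    (by fun_prop) (by fun_prop)
  simp only [Real.cos_zero, Real.cos_pi, mul_one, mul_neg] at h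
  rw [intervalIntegral.integral_symm, ← h, ← intervalIntegral.integral_neg,
    ← intervalIntegral.integral_const_mul]
  refine intervalIntegral.integral_congr fun θ hθ => ?_
  rw [Set.uIcc_of_le Real.pi_pos.le] at hθ
  have hsin : 0 ≤ Real.sin θ := Real.sin_nonneg_of_nonneg_of_le_pi hθ.1 hθ.2
  have hsqrt : Real.sqrt (ρ ^ 2 - (ρ * Real.cos θ) ^ 2) = ρ * Real.sin θ := by
    rw [show ρ ^ 2 - (ρ * Real.cos θ) ^ 2 = (ρ * Real.sin θ) ^ 2 by
      rw [mul_pow, mul_pow, Real.sin_sq]; ring, Real.sqrt_sq (by positivity)]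
  simp only [Function.comp_apply, hsqrt, Complex.real_smul]
  push_cast
  ring

/-- Integration of a plane wave over a ball of `ℝ^{k+1}`. -/
theorem setIntegral_ball_inner {k : ℕ} {φ : ℝ → ℂ} (hφ : Continuous φ) {ρ : ℝ} (hρ : 0 < ρ)
    {u : EuclideanSpace ℝ (Fin (k + 1))} (hu : ‖u‖ = 1) :
    ∫ ξ in Metric.ball (0 : EuclideanSpace ℝ (Fin (k + 1))) ρ, φ (inner ℝ u ξ) =
      ((volume.real (Metric.ball (0 : EuclideanSpace ℝ (Fin k)) 1) * ρ ^ (k + 1) : ℝ) : ℂ) *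
        ∫ θ in (0 : ℝ)..Real.pi, (Real.sin θ : ℂ) ^ (k + 1) * φ (ρ * Real.cos θ) := by
  rw [← integral_slices_eq hφ hρ, ← setIntegral_ball_coord hφ hρ]
  set e : EuclideanSpace ℝ (Fin (k + 1)) := EuclideanSpace.single 0 1 with he
  -- Reflection in the hyperplane orthogonal to `u - e` carries the unit vector `u` to `e`, so the
  -- wave may be taken along the first axis.
  set L := Submodule.reflection (Submodule.span ℝ {u - e})ᗮ with hL
  have hLu : L u = e := Submodule.reflection_sub (by rw [hu, he]; simp)
  rw [← setIntegral_ball_comp_isometry L (fun η => φ (η 0)) ρ]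
  congr 1
  ext ξ
  have : inner ℝ u ξ = (L ξ) 0 := by
    rw [← L.inner_map_map u ξ, hLu, he, EuclideanSpace.inner_single_left]
    simp
  rw [this]

/-! ### Removing radial weights. -/

/-- Layer-cake estimate: the integral over a ball of a radial function times `F` is controlled by
the integrals of `F` over the concentric balls. -/
theorem norm_setIntegral_ball_radial_mul_le {E : Type*} [NormedAddCommGroup E]
    [InnerProductSpace ℝ E] [FiniteDimensional ℝ E] [MeasurableSpace E] [BorelSpace E]
    [Nontrivial E] {F : E → ℂ} (hF : Continuous F) {f f' : ℝ → ℝ} {R L N : ℝ} (hR : 0 < R)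
    (hf : ∀ ρ, 0 < ρ → HasDerivAt f (f' ρ) ρ) (hf'c : ContinuousOn f' (Set.Ioi 0))
    (hf'm : Measurable f')
    (hL : ∀ ρ, 0 < ρ → ρ ≤ R → ∀ ξ, ‖ξ‖ < ρ → |f' ρ| * ‖F ξ‖ ≤ L)
    (hN : ∀ ρ, 0 < ρ → ρ ≤ R → |f' ρ| * ‖∫ ξ in Metric.ball (0 : E) ρ, F ξ‖ ≤ N) :
    ‖∫ ξ in Metric.ball (0 : E) R, (f ‖ξ‖ : ℂ) * F ξ‖ ≤
      |f R| * ‖∫ ξ in Metric.ball (0 : E) R, F ξ‖ + N * R := by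
  have hL0 : 0 ≤ L := le_trans (by positivity) (hL R hR le_rfl 0 (by simpa using hR))
  set S : Set (E × ℝ) := {p | ‖p.1‖ < p.2 ∧ p.2 ≤ R} with hS
  have hSm : MeasurableSet S := by
    have h1 : MeasurableSet {p : E × ℝ | ‖p.1‖ < p.2} :=
      measurableSet_lt (by fun_prop) (by fun_prop)
    have h2 : MeasurableSet {p : E × ℝ | p.2 ≤ R} := measurableSet_le (by fun_prop) (by fun_prop)
    exact h1.inter h2
  set H : E × ℝ → ℂ := S.indicator fun p => (f' p.2 : ℂ) * F p.1 with hH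
  have hfin : IsFiniteMeasure ((volume : Measure E).restrict (Metric.ball 0 R)) :=
    ⟨by simpa using measure_ball_lt_top⟩
  -- The bound `L` serves only to justify Fubini on a finite measure space; it does not enter the
  -- final estimate.
  have hHi : Integrable H ((volume.restrict (Metric.ball (0 : E) R)).prod
      (volume.restrict (Set.Ioc 0 R))) := by
    refine Integrable.of_bound (C := L) ?_ (Filter.Eventually.of_forall fun p => ?_)
    · refine (Measurable.indicator ?_ hSm).aestronglyMeasurable
      have := hF.measurable
      fun_prop
    · by_cases hp : p ∈ S
      · rw [hH, Set.indicator_of_mem hp, norm_mul, Complex.norm_real]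
        exact hL _ ((norm_nonneg _).trans_lt hp.1) hp.2 _ hp.1
      · rw [hH, Set.indicator_of_notMem hp, norm_zero]; exact hL0
  have hFi : IntegrableOn F (Metric.ball (0 : E) R) :=
    (hF.continuousOn.integrableOn_compact (isCompact_closedBall (0 : E) R)).mono_set
      Metric.ball_subset_closedBall
  -- The fundamental theorem of calculus on `[‖ξ‖, R]`. The origin is excluded, since `f` is
  -- controlled only on `ρ > 0`.
  have hinner : ∀ᵐ ξ ∂(volume.restrict (Metric.ball (0 : E) R)),
      (f ‖ξ‖ : ℂ) * F ξ = (f R : ℂ) * F ξ - ∫ ρ in Set.Ioc 0 R, H (ξ, ρ) := by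
    rw [ae_restrict_iff' measurableSet_ball]
    filter_upwards [compl_mem_ae_iff.2 (measure_singleton (μ := (volume : Measure E)) 0)]
      with ξ hξ0 hξR
    have hξ : 0 < ‖ξ‖ := norm_pos_iff.2 (by simpa using hξ0)
    have hξR' : ‖ξ‖ < R := by simpa using hξR
    have h1 : ∀ ρ, H (ξ, ρ) = (Set.Ioc ‖ξ‖ R).indicator (fun ρ => (f' ρ : ℂ) * F ξ) ρ :=
      fun ρ => rfl
    simp only [h1]
    rw [setIntegral_indicator measurableSet_Ioc,
      Set.inter_eq_right.2 (Set.Ioc_subset_Ioc_left hξ.le), integral_mul_const,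
      integral_complex_ofReal, ← intervalIntegral.integral_of_le hξR'.le]
    have hsub : Set.uIcc ‖ξ‖ R ⊆ Set.Ioi 0 := fun t ht => by
      rw [Set.uIcc_of_le hξR'.le] at ht
      exact hξ.trans_le ht.1
    rw [intervalIntegral.integral_eq_sub_of_hasDerivAt (fun ρ hρ => hf ρ (hsub hρ))
      (hf'c.mono hsub).intervalIntegrable]
    push_cast; ring
  have houter : ∀ ρ ∈ Set.Ioc 0 R, ∫ ξ in Metric.ball (0 : E) R, H (ξ, ρ) =
      (f' ρ : ℂ) * ∫ ξ in Metric.ball (0 : E) ρ, F ξ := fun ρ hρ => by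
    have h1 : ∀ ξ, H (ξ, ρ) = (Metric.ball (0 : E) ρ).indicator (fun ξ => (f' ρ : ℂ) * F ξ) ξ :=
      fun ξ => by
        simp only [hH, Set.indicator, hS, Set.mem_ofPred_eq, hρ.2, and_true, mem_ball_zero_iff]
    simp only [h1]
    rw [setIntegral_indicator measurableSet_ball,
      Set.inter_eq_right.2 (Metric.ball_subset_ball hρ.2), integral_const_mul]
  rw [integral_congr_ae hinner, integral_sub (hFi.const_mul _) hHi.integral_prod_left,
    integral_const_mul, integral_integral_swap (f := fun ξ ρ => H (ξ, ρ)) hHi,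
    setIntegral_congr_fun measurableSet_Ioc houter]
  refine (norm_sub_le _ _).trans (add_le_add ?_ ?_)
  · rw [norm_mul, Complex.norm_real, Real.norm_eq_abs]
  · have := norm_setIntegral_le_of_norm_le_const (μ := volume) (s := Set.Ioc 0 R) (C := N)
      (f := fun ρ => (f' ρ : ℂ) * ∫ ξ in Metric.ball (0 : E) ρ, F ξ) (by simp)
      (fun ρ hρ => by
        rw [norm_mul, Complex.norm_real]
        exact hN ρ hρ.1 hρ.2)
    simpa [hR.le] using this

/-! ### Decay of plane-wave integrals over balls, uniformly in the radius. -/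

/-- The plane wave `e^{ir⟨u, ξ⟩}`. -/
noncomputable def planeWave {E : Type*} [NormedAddCommGroup E] [InnerProductSpace ℝ E]
    (r : ℝ) (u ξ : E) : ℂ := Complex.exp (Complex.I * r * (inner ℝ u ξ : ℝ))

theorem norm_planeWave {E : Type*} [NormedAddCommGroup E] [InnerProductSpace ℝ E]
    (r : ℝ) (u ξ : E) : ‖planeWave r u ξ‖ = 1 := by
  rw [planeWave, show Complex.I * r * (inner ℝ u ξ : ℝ) =
    ((r * inner ℝ u ξ : ℝ) : ℂ) * Complex.I by push_cast; ring, Complex.norm_exp_ofReal_mul_I]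

@[fun_prop]
theorem continuous_planeWave {E : Type*} [NormedAddCommGroup E] [InnerProductSpace ℝ E]
    (r : ℝ) (u : E) : Continuous (planeWave r u) := by
  unfold planeWave; fun_prop

/-- The power of `ρ` that remains is `(k + 1) - (k + 2)/2 = k/2 ≥ 0`, hence the bound is uniform for
`ρ ≤ π`. -/
theorem mul_pow_div_rpow_le {k : ℕ} {c C ρ r : ℝ} (hc : 0 ≤ c) (hC : 0 ≤ C) (hρ : 0 < ρ)
    (hρπ : ρ ≤ Real.pi) (hr : 0 < r) :
    c * ρ ^ (k + 1) * (C / (r * ρ) ^ ((((k + 1 : ℕ) : ℝ) + 1) / 2)) ≤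
      c * C * Real.pi ^ ((k : ℝ) / 2) / r ^ ((((k + 1 : ℕ) : ℝ) + 1) / 2) := by
  have h : ρ ^ (k + 1) = ρ ^ ((k : ℝ) / 2) * ρ ^ ((((k + 1 : ℕ) : ℝ) + 1) / 2) := by
    rw [← Real.rpow_add hρ, ← Real.rpow_natCast]
    congr 1; push_cast; ring
  rw [Real.mul_rpow hr.le hρ.le, h]
  have h1 : ρ ^ ((k : ℝ) / 2) ≤ Real.pi ^ ((k : ℝ) / 2) :=
    Real.rpow_le_rpow hρ.le hρπ (by positivity)
  have h2 : 0 < ρ ^ ((((k + 1 : ℕ) : ℝ) + 1) / 2) := by positivity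
  have h3 : 0 < r ^ ((((k + 1 : ℕ) : ℝ) + 1) / 2) := by positivity
  generalize ρ ^ ((((k + 1 : ℕ) : ℝ) + 1) / 2) = q at *
  generalize r ^ ((((k + 1 : ℕ) : ℝ) + 1) / 2) = p at *
  calc c * (ρ ^ ((k : ℝ) / 2) * q) * (C / (p * q)) = c * C * ρ ^ ((k : ℝ) / 2) / p := by
        field_simp
    _ ≤ _ := by gcongr

/-- Decay of the Fourier transforms of balls and of their first moments. -/
theorem exists_bound_ball_planeWave (k : ℕ) : ∃ C : ℝ, 0 ≤ C ∧
    ∀ (u : EuclideanSpace ℝ (Fin (k + 1))) (r ρ : ℝ), ‖u‖ = 1 → 0 < r → 0 < ρ → ρ ≤ Real.pi →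
      ‖∫ ξ in Metric.ball (0 : EuclideanSpace ℝ (Fin (k + 1))) ρ, planeWave r u ξ‖ ≤
        C / r ^ ((((k + 1 : ℕ) : ℝ) + 1) / 2) ∧
      ‖∫ ξ in Metric.ball (0 : EuclideanSpace ℝ (Fin (k + 1))) ρ,
        ((inner ℝ u ξ : ℝ) : ℂ) * planeWave r u ξ‖ ≤
        ρ * (C / r ^ ((((k + 1 : ℕ) : ℝ) + 1) / 2)) := by
  obtain ⟨C, hC0, hC⟩ := exists_bound_sinInt (k + 1)
  set c := volume.real (Metric.ball (0 : EuclideanSpace ℝ (Fin k)) 1) with hc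
  have hc0 : 0 ≤ c := measureReal_nonneg
  refine ⟨c * C * Real.pi ^ ((k : ℝ) / 2), by positivity, fun u r ρ hu hr hρ hρπ => ?_⟩
  obtain ⟨hA, hB⟩ := hC (r * ρ) (by positivity)
  have key := mul_pow_div_rpow_le (k := k) hc0 hC0 hρ hρπ hr
  have hphase : ∀ θ : ℝ, Complex.exp (Complex.I * r * ((ρ * Real.cos θ : ℝ) : ℂ)) =
      cosPhase (r * ρ) θ := fun θ => by
    rw [cosPhase]; congr 1; push_cast; ring
  have hn : ‖((c * ρ ^ (k + 1) : ℝ) : ℂ)‖ = c * ρ ^ (k + 1) := by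
    rw [Complex.norm_real, Real.norm_of_nonneg (by positivity)]
  constructor
  · have h := setIntegral_ball_inner (k := k)
      (φ := fun t : ℝ => Complex.exp (Complex.I * r * (t : ℂ))) (by fun_prop) hρ hu
    simp only [hphase] at h
    unfold planeWave
    rw [h, norm_mul, hn]
    exact (mul_le_mul_of_nonneg_left hA (by positivity)).trans key
  · have h := setIntegral_ball_inner (k := k)
      (φ := fun t : ℝ => (t : ℂ) * Complex.exp (Complex.I * r * (t : ℂ))) (by fun_prop) hρ hu
    simp only [hphase] at h
    unfold planeWave
    have h2 : ∫ θ in (0 : ℝ)..Real.pi, (Real.sin θ : ℂ) ^ (k + 1) *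
        (((ρ * Real.cos θ : ℝ) : ℂ) * cosPhase (r * ρ) θ) = ρ * cosSinInt (k + 1) (r * ρ) := by
      rw [cosSinInt, ← intervalIntegral.integral_const_mul]
      congr 1; ext θ; rw [Complex.ofReal_mul]; ring
    rw [h, h2, norm_mul, norm_mul, hn, Complex.norm_real, Real.norm_of_nonneg hρ.le]
    calc c * ρ ^ (k + 1) * (ρ * ‖cosSinInt (k + 1) (r * ρ)‖) =
          ρ * (c * ρ ^ (k + 1) * ‖cosSinInt (k + 1) (r * ρ)‖) := by ring
      _ ≤ _ := by
        gcongr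
        exact (mul_le_mul_of_nonneg_left hB (by positivity)).trans key

/-! ### Hyperbolic weights. -/

/-- For `y ≥ 0`, `2 sinh y = e^y (1 - e^{-2y})` and `1 - e^{-2y} ≤ 2y`. The linear factor cancels
one power of `ρ` in the derivative of `sinh(aρ)/ρ`. -/
theorem abs_sinh_le_mul_exp (y : ℝ) : |Real.sinh y| ≤ |y| * Real.exp |y| := by
  wlog hy : 0 ≤ y generalizing y
  · simpa using this (-y) (by linarith)
  rw [abs_of_nonneg (Real.sinh_nonneg_iff.2 hy), abs_of_nonneg hy, Real.sinh_eq]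
  have h1 := Real.add_one_le_exp (-(2 * y))
  have h2 : Real.exp (-y) = Real.exp y * Real.exp (-(2 * y)) := by rw [← Real.exp_add]; ring_nf
  rw [h2]
  nlinarith [Real.exp_pos y]

theorem cosh_le_exp_abs (y : ℝ) : Real.cosh y ≤ Real.exp |y| := by
  rw [Real.cosh_eq]
  linarith [Real.exp_le_exp.2 (le_abs_self y), Real.exp_le_exp.2 (neg_le_abs y)]

theorem abs_sinh_le_exp_abs (y : ℝ) : |Real.sinh y| ≤ Real.exp |y| := by
  rw [Real.sinh_eq, abs_le]
  constructor <;>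
  linarith [Real.exp_le_exp.2 (le_abs_self y), Real.exp_le_exp.2 (neg_le_abs y),
    Real.exp_pos y, Real.exp_pos (-y)]

theorem exp_abs_mul_le {a ρ R : ℝ} (h0 : 0 < ρ) (h : ρ ≤ R) :
    Real.exp |a * ρ| ≤ Real.exp (|a| * R) := by
  rw [abs_mul, abs_of_pos h0]; gcongr

theorem exists_bound_cosh_planeWave (k : ℕ) : ∃ C : ℝ, 0 ≤ C ∧
    ∀ (u : EuclideanSpace ℝ (Fin (k + 1))) (r a : ℝ), ‖u‖ = 1 → 0 < r →
      ‖∫ ξ in Metric.ball (0 : EuclideanSpace ℝ (Fin (k + 1))) Real.pi,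
        (Real.cosh (a * ‖ξ‖) : ℂ) * planeWave r u ξ‖ ≤
        C * ((1 + |a|) * Real.exp (|a| * Real.pi) / r ^ ((((k + 1 : ℕ) : ℝ) + 1) / 2)) := by
  obtain ⟨C, hC0, hC⟩ := exists_bound_ball_planeWave k
  refine ⟨C * (1 + Real.pi), by positivity, fun u r a hu hr => ?_⟩
  have hπ := Real.pi_pos
  have hp : 0 < r ^ ((((k + 1 : ℕ) : ℝ) + 1) / 2) := by positivity
  have hf' : ∀ ρ, 0 < ρ → ρ ≤ Real.pi →
      |a * Real.sinh (a * ρ)| ≤ |a| * Real.exp (|a| * Real.pi) := fun ρ h0 h => by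
    rw [abs_mul]
    gcongr
    exact (abs_sinh_le_exp_abs _).trans (exp_abs_mul_le h0 h)
  have := norm_setIntegral_ball_radial_mul_le (continuous_planeWave r u)
    (f := fun ρ => Real.cosh (a * ρ)) (f' := fun ρ => a * Real.sinh (a * ρ)) (R := Real.pi)
    (L := |a| * Real.exp (|a| * Real.pi))
    (N := |a| * Real.exp (|a| * Real.pi) * (C / r ^ ((((k + 1 : ℕ) : ℝ) + 1) / 2))) hπ
    (fun ρ _ => (((hasDerivAt_id ρ).const_mul a).cosh).congr_deriv (by simp; ring))
    (by fun_prop) (by fun_prop)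
    (fun ρ h0 h ξ _ => by rw [norm_planeWave, mul_one]; exact hf' ρ h0 h)
    (fun ρ h0 h => mul_le_mul (hf' ρ h0 h) (hC u r ρ hu hr h0 h).1 (norm_nonneg _) (by positivity))
  refine this.trans ?_
  have h1 : |Real.cosh (a * Real.pi)| ≤ Real.exp (|a| * Real.pi) := by
    rw [abs_of_pos (Real.cosh_pos _)]
    exact (cosh_le_exp_abs _).trans (exp_abs_mul_le hπ le_rfl)
  refine (add_le_add_left (mul_le_mul h1 (hC u r Real.pi hu hr hπ le_rfl).1 (norm_nonneg _)
    (by positivity)) _).trans ?_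
  set T := Real.exp (|a| * Real.pi) * (C / r ^ ((((k + 1 : ℕ) : ℝ) + 1) / 2)) with hT
  have hT0 : 0 ≤ T := by positivity
  rw [show C * (1 + Real.pi) * ((1 + |a|) * Real.exp (|a| * Real.pi) /
    r ^ ((((k + 1 : ℕ) : ℝ) + 1) / 2)) = (1 + Real.pi) * (1 + |a|) * T by rw [hT]; ring]
  have h2 := mul_nonneg (abs_nonneg a) hT0
  have h3 := mul_nonneg hπ.le hT0
  rw [show |a| * Real.exp (|a| * Real.pi) * (C / r ^ ((((k + 1 : ℕ) : ℝ) + 1) / 2)) =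
    |a| * T by rw [hT]; ring]
  nlinarith

theorem exists_bound_sinh_planeWave (k : ℕ) : ∃ C : ℝ, 0 ≤ C ∧
    ∀ (u : EuclideanSpace ℝ (Fin (k + 1))) (r a : ℝ), ‖u‖ = 1 → 0 < r →
      ‖∫ ξ in Metric.ball (0 : EuclideanSpace ℝ (Fin (k + 1))) Real.pi,
        ((Real.sinh (a * ‖ξ‖) / ‖ξ‖ : ℝ) : ℂ) *
          (((inner ℝ u ξ : ℝ) : ℂ) * planeWave r u ξ)‖ ≤
        C * ((1 + |a|) * Real.exp (|a| * Real.pi) / r ^ ((((k + 1 : ℕ) : ℝ) + 1) / 2)) := by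
  obtain ⟨C, hC0, hC⟩ := exists_bound_ball_planeWave k
  refine ⟨C * (1 + 2 * Real.pi), by positivity, fun u r a hu hr => ?_⟩
  have hπ := Real.pi_pos
  have hp : 0 < r ^ ((((k + 1 : ℕ) : ℝ) + 1) / 2) := by positivity
  -- The factor `1/ρ` allowed here is absorbed by `|⟨u,ξ⟩| ≤ ρ` in the pointwise bound, and by the
  -- factor `ρ` in the first-moment estimate.
  have hf' : ∀ ρ, 0 < ρ → ρ ≤ Real.pi →
      |(a * Real.cosh (a * ρ) * ρ - Real.sinh (a * ρ)) / ρ ^ 2| ≤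
        2 * |a| * Real.exp (|a| * Real.pi) / ρ := fun ρ h0 h => by
    have e1 := exp_abs_mul_le (a := a) h0 h
    have h1 : |a * Real.cosh (a * ρ) * ρ| ≤ |a| * Real.exp (|a| * Real.pi) * ρ := by
      rw [abs_mul, abs_mul, abs_of_pos (Real.cosh_pos _), abs_of_pos h0]
      gcongr
      exact (cosh_le_exp_abs _).trans e1
    have h2 : |Real.sinh (a * ρ)| ≤ |a| * Real.exp (|a| * Real.pi) * ρ := by
      refine (abs_sinh_le_mul_exp _).trans ?_
      rw [abs_mul a ρ, abs_of_pos h0, mul_right_comm]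
      rw [abs_mul, abs_of_pos h0] at e1
      gcongr
    rw [abs_div, abs_of_pos (by positivity : 0 < ρ ^ 2), div_le_div_iff₀ (by positivity) h0]
    have h3 := mul_le_mul_of_nonneg_right ((abs_sub _ _).trans (add_le_add h1 h2)) h0.le
    nlinarith
  have := norm_setIntegral_ball_radial_mul_le
    (F := fun ξ => ((inner ℝ u ξ : ℝ) : ℂ) * planeWave r u ξ) (by fun_prop)
    (f := fun ρ => Real.sinh (a * ρ) / ρ)
    (f' := fun ρ => (a * Real.cosh (a * ρ) * ρ - Real.sinh (a * ρ)) / ρ ^ 2) (R := Real.pi)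
    (L := 2 * |a| * Real.exp (|a| * Real.pi))
    (N := 2 * |a| * Real.exp (|a| * Real.pi) * (C / r ^ ((((k + 1 : ℕ) : ℝ) + 1) / 2))) hπ
    (fun ρ h => ((((hasDerivAt_id ρ).const_mul a).sinh).div (hasDerivAt_id ρ) h.ne').congr_deriv
      (by simp; ring))
    (ContinuousOn.div (by fun_prop) (by fun_prop) fun ρ h => pow_ne_zero _ (ne_of_gt h))
    (by fun_prop)
    (fun ρ h0 h ξ hξ => by
      rw [norm_mul, norm_planeWave, mul_one, Complex.norm_real]
      have h4 : ‖inner ℝ u ξ‖ ≤ ρ := by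
        have := norm_inner_le_norm (𝕜 := ℝ) u ξ
        rw [hu, one_mul] at this
        exact this.trans hξ.le
      refine (mul_le_mul (hf' ρ h0 h) h4 (norm_nonneg _) (by positivity)).trans ?_
      rw [div_mul_cancel₀ _ h0.ne'])
    (fun ρ h0 h => by
      refine (mul_le_mul (hf' ρ h0 h) (hC u r ρ hu hr h0 h).2 (norm_nonneg _)
        (by positivity)).trans ?_
      rw [← mul_assoc, div_mul_cancel₀ _ h0.ne'])
  refine this.trans ?_
  have h1 : |Real.sinh (a * Real.pi) / Real.pi| ≤ Real.exp (|a| * Real.pi) / Real.pi := by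
    rw [abs_div, abs_of_pos hπ]
    gcongr
    exact (abs_sinh_le_exp_abs _).trans (exp_abs_mul_le hπ le_rfl)
  refine (add_le_add_left (mul_le_mul h1 (hC u r Real.pi hu hr hπ le_rfl).2 (norm_nonneg _)
    (by positivity)) _).trans ?_
  rw [← mul_assoc (Real.exp (|a| * Real.pi) / Real.pi), div_mul_cancel₀ _ hπ.ne']
  set T := Real.exp (|a| * Real.pi) * (C / r ^ ((((k + 1 : ℕ) : ℝ) + 1) / 2)) with hT
  have hT0 : 0 ≤ T := by positivity
  rw [show C * (1 + 2 * Real.pi) * ((1 + |a|) * Real.exp (|a| * Real.pi) /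
    r ^ ((((k + 1 : ℕ) : ℝ) + 1) / 2)) = (1 + 2 * Real.pi) * (1 + |a|) * T by rw [hT]; ring]
  have h2 := mul_nonneg (abs_nonneg a) hT0
  have h3 := mul_nonneg hπ.le hT0
  rw [show 2 * |a| * Real.exp (|a| * Real.pi) * (C / r ^ ((((k + 1 : ℕ) : ℝ) + 1) / 2)) =
    2 * |a| * T by rw [hT]; ring]
  nlinarith

/-! ### Clifford-valued integrals and the final bound. -/

theorem vec_add {m : ℕ} (ξ η : EuclideanSpace ℝ (Fin m)) : vec (ξ + η) = vec ξ + vec η := by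
  simp [vec, add_smul, Finset.sum_add_distrib]

theorem vec_smul {m : ℕ} (t : ℝ) (ξ : EuclideanSpace ℝ (Fin m)) :
    vec (t • ξ) = (t : ℂ) • vec ξ := by
  simp [vec, Finset.smul_sum, mul_smul]

/-- The vector-valued integral of a density that is symmetric about the axis `u` is directed
along `u`. -/
theorem setIntegral_smul_vec {m : ℕ} {u : EuclideanSpace ℝ (Fin m)} (hu : ‖u‖ = 1)
    {w : EuclideanSpace ℝ (Fin m) → ℂ} {R : ℝ}
    (hw : ∀ ξ η, ‖ξ‖ = ‖η‖ → inner ℝ u ξ = inner ℝ u η → w ξ = w η)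
    (hint : IntegrableOn (fun ξ => w ξ • vec ξ) (Metric.ball 0 R)) :
    ∫ ξ in Metric.ball 0 R, w ξ • vec ξ =
      (∫ ξ in Metric.ball 0 R, w ξ * ((inner ℝ u ξ : ℝ) : ℂ)) • vec u := by
  -- This reflection fixes `u` and preserves both the ball and the density, while `Lξ + ξ =
  -- 2⟨u,ξ⟩u`; averaging the integral with its reflected copy leaves only the component along `u`.
  set L := Submodule.reflection (Submodule.span ℝ {u}) with hL
  have hLξ : ∀ ξ, L ξ + ξ = (2 * inner ℝ u ξ : ℝ) • u := fun ξ => by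
    rw [hL, Submodule.reflection_singleton_apply, hu]
    simp [mul_smul, two_smul]
  have hLu : L u = u :=
    Submodule.reflection_mem_subspace_eq_self (Submodule.mem_span_singleton_self u)
  have hwL : ∀ ξ, w (L ξ) = w ξ := fun ξ =>
    hw _ _ (L.norm_map ξ) (by rw [← L.inner_map_map u ξ, hLu])
  have hpre : L ⁻¹' Metric.ball 0 R = Metric.ball 0 R := by ext ξ; simp
  have hint' : IntegrableOn (fun ξ => w ξ • vec (L ξ)) (Metric.ball 0 R) := by
    have h := (L.measurePreserving.integrableOn_comp_preimage
      L.toHomeomorph.measurableEmbedding).2 hint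
    rw [hpre] at h
    refine h.congr (Filter.Eventually.of_forall fun ξ => ?_)
    simp only [Function.comp_apply, hwL]
  have h1 : ∫ ξ in Metric.ball 0 R, w ξ • vec (L ξ) = ∫ ξ in Metric.ball 0 R, w ξ • vec ξ := by
    rw [← setIntegral_ball_comp_isometry L (fun ξ => w ξ • (vec ξ : Cl m)) R]
    simp only [hwL]
  have h2 : (∫ ξ in Metric.ball 0 R, w ξ • vec (L ξ)) + ∫ ξ in Metric.ball 0 R, w ξ • vec ξ =
      (2 : ℂ) • (∫ ξ in Metric.ball 0 R, w ξ * ((inner ℝ u ξ : ℝ) : ℂ)) • vec u := by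
    rw [← integral_add hint' hint, ← integral_smul_const, ← integral_smul]
    congr 1
    ext ξ
    rw [← smul_add, ← vec_add, hLξ, vec_smul, smul_smul, smul_smul]
    congr 1; push_cast; ring
  rw [h1, ← two_smul ℂ] at h2
  exact smul_right_injective _ two_ne_zero h2

theorem monogenicExp_eq {m : ℕ} (x : Paravector m) (ξ : EuclideanSpace ℝ (Fin m)) :
    monogenicExp x ξ =
      (Complex.exp (Complex.I * (inner ℝ x.2 ξ : ℝ)) * (Real.cosh (x.1 * ‖ξ‖) : ℂ)) • (1 : Cl m) -
      (Complex.I * (Complex.exp (Complex.I * (inner ℝ x.2 ξ : ℝ)) *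
        ((Real.sinh (x.1 * ‖ξ‖) / ‖ξ‖ : ℝ) : ℂ))) • vec ξ := by
  rw [monogenicExp, expPlus, expMinus, chiPlus, chiMinus, Real.cosh_eq, Real.sinh_eq]
  push_cast
  module

theorem exists_bound_sincB (k : ℕ) :
    ∃ M : ℝ, ∀ x : Paravector (k + 1), 1 ≤ ‖x.2‖ → ‖sincB x‖ ≤
      M * ((1 + |x.1|) * Real.exp (|x.1| * Real.pi) /
        ‖x.2‖ ^ ((((k + 1 : ℕ) : ℝ) + 1) / 2)) := by
  obtain ⟨C₁, hC₁, h₁⟩ := exists_bound_cosh_planeWave k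
  obtain ⟨C₂, hC₂, h₂⟩ := exists_bound_sinh_planeWave k
  set G := ∑ j : Fin (k + 1), ‖(gen j : Cl (k + 1))‖ with hG
  refine ⟨‖((1 / (2 * Real.pi) ^ (k + 1) : ℝ) : ℂ)‖ * (C₁ * ‖(1 : Cl (k + 1))‖ + C₂ * G),
    fun x hx => ?_⟩
  set r := ‖x.2‖ with hr
  have hr0 : 0 < r := by linarith
  set u := r⁻¹ • x.2 with hu
  have hu1 : ‖u‖ = 1 := by
    rw [hu, norm_smul, norm_inv, norm_norm, ← hr, inv_mul_cancel₀ hr0.ne']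
  have hxu : x.2 = r • u := by rw [hu, smul_smul, mul_inv_cancel₀ hr0.ne', one_smul]
  have hwave : ∀ ξ, Complex.exp (Complex.I * (inner ℝ x.2 ξ : ℝ)) = planeWave r u ξ := fun ξ => by
    rw [planeWave, hxu, real_inner_smul_left]; congr 1; push_cast; ring
  set B := Metric.ball (0 : EuclideanSpace ℝ (Fin (k + 1))) Real.pi with hB
  set g := fun ξ => planeWave r u ξ * (Real.cosh (x.1 * ‖ξ‖) : ℂ) with hg
  set w := fun ξ => planeWave r u ξ * ((Real.sinh (x.1 * ‖ξ‖) / ‖ξ‖ : ℝ) : ℂ) with hw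
  have hexp : ∀ ξ, monogenicExp x ξ = g ξ • (1 : Cl (k + 1)) - Complex.I • w ξ • vec ξ :=
    fun ξ => by rw [monogenicExp_eq, hwave, smul_smul]
  have hgi : IntegrableOn (fun ξ => g ξ • (1 : Cl (k + 1))) B :=
    (Continuous.continuousOn (by fun_prop)).integrableOn_compact
      (isCompact_closedBall (0 : EuclideanSpace ℝ (Fin (k + 1))) Real.pi) |>.mono_set
      Metric.ball_subset_closedBall
  -- Solving `hexp` for the vector term gives its integrability from that of the exponential, with
  -- no separate estimate of `sinh(a|ξ|)/|ξ|` near the origin.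
  have hwi : IntegrableOn (fun ξ => w ξ • (vec ξ : Cl (k + 1))) B := by
    refine ((hgi.sub (integrableOn_monogenicExp x)).smul (-Complex.I)).congr
      (Filter.Eventually.of_forall fun ξ => ?_)
    simp only [Pi.smul_apply, Pi.sub_apply, hexp, sub_sub_cancel, smul_smul]
    rw [← mul_assoc, neg_mul, Complex.I_mul_I, neg_neg, one_mul]
  have hv := setIntegral_smul_vec hu1 (w := w) (R := Real.pi)
    (fun ξ η h h' => by simp only [hw, planeWave, h, h']) hwi
  set T := (1 + |x.1|) * Real.exp (|x.1| * Real.pi) / r ^ ((((k + 1 : ℕ) : ℝ) + 1) / 2) with hT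
  have hgn : ‖∫ ξ in B, g ξ‖ ≤ C₁ * T := by
    have := h₁ u r x.1 hu1 hr0
    simp only [mul_comm _ (planeWave _ _ _)] at this
    exact this
  have hwn : ‖∫ ξ in B, w ξ * ((inner ℝ u ξ : ℝ) : ℂ)‖ ≤ C₂ * T := by
    have := h₂ u r x.1 hu1 hr0
    have e : ∀ ξ, w ξ * ((inner ℝ u ξ : ℝ) : ℂ) = ((Real.sinh (x.1 * ‖ξ‖) / ‖ξ‖ : ℝ) : ℂ) *
          (((inner ℝ u ξ : ℝ) : ℂ) * planeWave r u ξ) := fun ξ => by simp only [hw]; ring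
    simp only [e]
    exact this
  have hvu : ‖(vec u : Cl (k + 1))‖ ≤ G := by simpa [hu1] using norm_vec_le u
  rw [sincB_eq, norm_smul, mul_assoc]
  refine mul_le_mul_of_nonneg_left ?_ (norm_nonneg _)
  simp only [hexp]
  have hIw : IntegrableOn (fun ξ => Complex.I • w ξ • (vec ξ : Cl (k + 1))) B :=
    hwi.smul Complex.I
  rw [integral_sub hgi hIw, integral_smul, hv, integral_smul_const]
  refine (norm_sub_le _ _).trans ?_
  rw [norm_smul, norm_smul, norm_smul, Complex.norm_I, one_mul, add_mul]
  refine add_le_add ?_ ?_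
  · rw [mul_right_comm]
    exact mul_le_mul_of_nonneg_right hgn (norm_nonneg _)
  · rw [mul_right_comm]
    exact mul_le_mul hwn hvu (norm_nonneg _) ((norm_nonneg _).trans hwn)

end CliffordPW

theorem lemma3p1 (m : ℕ) (hm : 1 ≤ m) :
    ∃ M : ℝ, ∀ x : CliffordPW.Paravector m, 1 ≤ ‖x.2‖ →
      ‖CliffordPW.sincB x‖ ≤
        M * ((1 + |x.1|) * Real.exp (|x.1| * Real.pi) / ‖x.2‖ ^ (((m : ℝ) + 1) / 2)) := by
  obtain ⟨k, rfl⟩ := Nat.exists_eq_add_of_le' hm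
  exact CliffordPW.exists_bound_sincB k
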